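/- Conventions. Let $\mathbb{F}$ be a field and let the variables $\mathbf{x}=\mathbf{x}_1\sqcup\cdots\sqcup\mathbf{x}_d$ be partitioned into $d\ge 1$ parts, each consisting of $n$ variables. A polynomial $f\in\mathbb{F}[\mathbf{x}]$ is *set-multilinear* if every monomial of $f$ contains exactly one variable (to the first power) from each part. Its *tensor rank* $\operatorname{TensorRank}(f)$ is the least $r$ such that $f=\sum_{i=1}^{r}\ell_{i1}(\mathbf{x}_1)\cdots\ell_{id}(\mathbf{x}_d)$, where each $\ell_{ij}$ is a linear form in the variables of $\mathbf{x}_j$. An *arithmetic formula* is a rooted tree whose leaves are labelled by variables or field constants and whose inner gates are product gates or sum gates of arbitrary fan-in, where edges into sum gates may carry field constants; its *size* is its number of gates (including leaves). It is *homogeneous* if every gate computes a homogeneous polynomial; it need not be set-multilinear. **Theorem.** There is an absolute constant $K>0$ such that the following holds. Let $c>0$ be a constant and let $d=d(n)\ge 1$ be a function of $n$ with $\log d=o(\log n)$ as $n\to\infty$. Then for all sufficiently large $n$ (depending only on $c$ and on the function $d$), every field $\mathbb{F}$, and every polynomial $f$ over $\mathbb{F}$ that is set-multilinear with respect to $\mathbf{x}=\mathbf{x}_1\sqcup\cdots\sqcup\mathbf{x}_d$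 with $|\mathbf{x}_i|=n$ for all $i$ and that is computed by a homogeneous formula (not necessarily set-multilinear) of size at most $n^c$, we have $$\operatorname{TensorRank}(f)\;\le\;\frac{n^{d}}{n^{d/\exp(Kc)}}.$$ -/

import Mathlib

open Filter Asymptotics

universe u v

/-- Arithmetic formulas over `F` with variables `σ`: rooted trees whose leaves are labelled by
variables or field constants and whose inner gates are sum gates (of arbitrary fan-in `k`, the edge
to the `i`-th child carrying the field constant `w i`) or product gates (of arbitrary fan-in). -/
inductive ArithFormula (F : Type u) (σ : Type v) : Type (max u v)
  | var (x : σ) : ArithFormula F σ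
  | const (a : F) : ArithFormula F σ
  | sum (k : ℕ) (w : Fin k → F) (g : Fin k → ArithFormula F σ) : ArithFormula F σ
  | prod (k : ℕ) (g : Fin k → ArithFormula F σ) : ArithFormula F σ

namespace ArithFormula

variable {F : Type u} {σ : Type v}

/-- The size of a formula: its number of gates (nodes of the tree), leaves included. -/
def size : ArithFormula F σ → ℕ
  | var _ => 1
  | const _ => 1
  | sum _ _ g => 1 + ∑ i, (g i).size
  | prod _ g => 1 + ∑ i, (g i).size

variable [CommSemiring F]

/-- The polynomial computed at the root of a formula. -/
noncomputable def toPoly : ArithFormula F σ → MvPolynomial σ F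
  | var x => MvPolynomial.X x
  | const a => MvPolynomial.C a
  | sum _ w g => ∑ i, MvPolynomial.C (w i) * (g i).toPoly
  | prod _ g => ∏ i, (g i).toPoly

/-- A formula is homogeneous if every gate of it computes a homogeneous polynomial. (Leaves always
do, with degree `1` or `0`.) -/
def IsHomogeneous : ArithFormula F σ → Prop
  | var _ => True
  | const _ => True
  | sum k w g => (∃ e : ℕ, (sum k w g).toPoly.IsHomogeneous e) ∧ ∀ i, (g i).IsHomogeneous
  | prod k g => (∃ e : ℕ, (prod k g).toPoly.IsHomogeneous e) ∧ ∀ i, (g i).IsHomogeneous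

end ArithFormula

section TensorRank

variable {F : Type u} [CommSemiring F] {d n : ℕ}

/-- The variables are `x_(j,k)` with `j : Fin d` and `k : Fin n`; the `j`-th part consists of the
`n` variables `x_(j,k)`. A polynomial is set-multilinear if each of its monomials contains exactly
one variable (with multiplicity) from each part. -/
def IsSetMultilinear (f : MvPolynomial (Fin d × Fin n) F) : Prop :=
  ∀ m ∈ f.support, ∀ j : Fin d, ∑ k : Fin n, m (j, k) = 1

/-- `f` is a sum of `r` set-multilinear products `ℓ_1(x_1) ⋯ ℓ_d(x_d)` of linear forms, where
`ℓ_j` only involves the variables in the `j`-th part. -/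
def HasTensorDecomposition (f : MvPolynomial (Fin d × Fin n) F) (r : ℕ) : Prop :=
  ∃ a : Fin r → Fin d → Fin n → F,
    f = ∑ i : Fin r, ∏ j : Fin d, ∑ k : Fin n,
      MvPolynomial.C (a i j k) * MvPolynomial.X (j, k)

/-- The tensor rank of `f`: the least `r` such that `f` is a sum of `r` set-multilinear products of
linear forms. -/
noncomputable def tensorRank (f : MvPolynomial (Fin d × Fin n) F) : ℕ :=
  sInf {r : ℕ | HasTensorDecomposition f r}

/-- Monomials with exactly one variable from each part have a decomposition with one term. -/
theorem hasTensorDecomposition_monomial (hd : 1 ≤ d) (m : Fin d × Fin n →₀ ℕ) (c : F)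
    (hm : ∀ j : Fin d, ∑ k : Fin n, m (j, k) = 1) :
    HasTensorDecomposition (MvPolynomial.monomial m c) 1 := by
  classical
  have key : ∀ j : Fin d, ∃ k : Fin n, ∀ k', m (j, k') = if k' = k then 1 else 0 := by
    intro j
    obtain ⟨k, -, hk⟩ : ∃ k ∈ Finset.univ, m (j, k) ≠ 0 := by
      apply Finset.exists_ne_zero_of_sum_ne_zero
      rw [hm j]; exact one_ne_zero
    refine ⟨k, fun k' => ?_⟩
    have h := hm j
    rw [← Finset.add_sum_erase _ _ (Finset.mem_univ k)] at h
    by_cases hk' : k' = k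
    · subst hk'; simp; omega
    · have h0 : ∑ x ∈ Finset.univ.erase k, m (j, x) = 0 := by omega
      simpa [hk'] using Finset.sum_eq_zero_iff.mp h0 k' (by simp [hk'])
  choose κ hκ using key
  let z : Fin d := ⟨0, hd⟩
  refine ⟨fun _ j k => if k = κ j then (if j = z then c else 1) else 0, ?_⟩
  have h1 : ∀ j : Fin d, (∑ k : Fin n,
      MvPolynomial.C (if k = κ j then (if j = z then c else 1) else 0) *
        MvPolynomial.X (R := F) (j, k))
      = MvPolynomial.C (if j = z then c else 1) * MvPolynomial.X (j, κ j) := by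
    intro j
    rw [Finset.sum_eq_single (κ j)]
    · simp
    · intro b _ hb; simp [hb]
    · simp
  have hX : ∏ j : Fin d, MvPolynomial.X (R := F) (j, κ j) = MvPolynomial.monomial m 1 := by
    rw [MvPolynomial.monomial_eq, Finsupp.prod_fintype _ _ (by simp), Fintype.prod_prod_type]
    simp [hκ, pow_ite]
  simp only [Finset.univ_unique, Finset.sum_singleton, h1, Finset.prod_mul_distrib, hX]
  rw [← map_prod, Finset.prod_ite_eq' Finset.univ z (fun _ => c)]
  simp [MvPolynomial.C_mul_monomial]

/-- For `d ≥ 1` the minimum in the definition of the tensor rank of a set-multilinear polynomial is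
taken over a nonempty set, hence it is attained. -/
theorem IsSetMultilinear.hasTensorDecomposition_tensorRank (hd : 1 ≤ d)
    {f : MvPolynomial (Fin d × Fin n) F} (hf : IsSetMultilinear f) :
    HasTensorDecomposition f (tensorRank f) := by
  classical
  refine Nat.sInf_mem (s := {r : ℕ | HasTensorDecomposition f r}) ?_
  have h : ∀ m ∈ f.support, HasTensorDecomposition (MvPolynomial.monomial m (f.coeff m)) 1 :=
    fun m hm => hasTensorDecomposition_monomial hd m _ (hf m hm)
  rw [MvPolynomial.as_sum f]
  generalize f.support = s at h
  induction s using Finset.induction_on with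
  | empty => exact ⟨0, Fin.elim0, by simp⟩
  | insert m s hms ih =>
    obtain ⟨r, a, ha⟩ := ih fun m' hm' => h m' (Finset.mem_insert_of_mem hm')
    obtain ⟨b, hb⟩ := h m (Finset.mem_insert_self _ _)
    refine ⟨1 + r, Fin.append b a, ?_⟩
    rw [Finset.sum_insert hms, ha, hb, Fin.sum_univ_add]
    simp

end TensorRank

/-! Write s for the formula size. Unfolding a homogeneous formula along paths that enter a
largest-degree child at each product gate writes a polynomial of degree e as a sum of at most s
products, each of at least log₂(2e) gate polynomials (`ArithFormula.isSumOf_gateProducts`).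
Re-expanding factors of degree above 2^q for k rounds, where kq·2^q ≥ d, gives at most s^k products
of at least m = ⌈d/2^q⌉ factors of positive degree.

The factors need not be set-multilinear, but only the set-multilinear coefficients of each product
matter. These are a sum, over at most d^d distributions of the parts among the factors, of products
of tensors in disjoint parts (`isSumOf_coeffTensor_prod`). A tensor of order e has rank at most
n^(e-1), so every factor saves one n, and the rank of f is at most s^k · d^d · n^(d-m)
(`tensorRank_le_of_homogeneous`).

With q ≈ 8c, the costs s^k and d^d = n^(o(d)) consume at most half of the saving n^(d/2^q) once d is
large. Small d is covered by the bound n^(d-1), and c < 1/2 by counting the variables that occur. -/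

/-! ### Calculus of sums with boundedly many terms -/

/-- `x` is a sum of at most `r` elements of `S`. -/
def IsSumOf {M : Type*} [AddCommMonoid M] (S : Set M) (r : ℕ) (x : M) : Prop :=
  ∃ l : Multiset M, (∀ y ∈ l, y ∈ S) ∧ l.sum = x ∧ Multiset.card l ≤ r

namespace IsSumOf

variable {M N : Type*} [AddCommMonoid M] [AddCommMonoid N] {S S' : Set M} {r r' : ℕ} {x y : M}

theorem zero : IsSumOf S r (0 : M) := ⟨0, by simp, by simp, by simp⟩

theorem of_mem (h : x ∈ S) : IsSumOf S 1 x := ⟨{x}, by simpa using h, by simp, by simp⟩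

theorem mono (h : IsSumOf S r x) (hr : r ≤ r') : IsSumOf S r' x := by
  obtain ⟨l, h1, h2, h3⟩ := h
  exact ⟨l, h1, h2, h3.trans hr⟩

theorem add (hx : IsSumOf S r x) (hy : IsSumOf S r' y) : IsSumOf S (r + r') (x + y) := by
  obtain ⟨l, h1, rfl, h3⟩ := hx
  obtain ⟨l', h1', rfl, h3'⟩ := hy
  refine ⟨l + l', fun z hz => ?_, by simp, by rw [Multiset.card_add]; omega⟩
  rcases Multiset.mem_add.1 hz with h | h
  exacts [h1 z h, h1' z h]

theorem sum {ι : Type*} {s : Finset ι} {f : ι → M} {k : ι → ℕ}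
    (h : ∀ i ∈ s, IsSumOf S (k i) (f i)) : IsSumOf S (∑ i ∈ s, k i) (∑ i ∈ s, f i) := by
  classical
  induction s using Finset.induction_on with
  | empty => exact zero
  | insert a s ha ih =>
    rw [Finset.sum_insert ha, Finset.sum_insert ha]
    exact (h a (by simp)).add (ih fun i hi => h i (by simp [hi]))

theorem map {S' : Set N} (φ : M →+ N) (h : IsSumOf S r x) (hφ : ∀ y ∈ S, IsSumOf S' r' (φ y)) :
    IsSumOf S' (r * r') (φ x) := by
  obtain ⟨l, h1, rfl, h3⟩ := h
  suffices H : IsSumOf S' (Multiset.card l * r') (φ l.sum) from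
    H.mono (Nat.mul_le_mul_right _ h3)
  clear h3
  induction l using Multiset.induction_on with
  | empty => simpa using zero
  | cons a l ih =>
    rw [Multiset.sum_cons, map_add, Multiset.card_cons, add_mul, one_mul,
      add_comm (Multiset.card l * r')]
    exact (hφ a (h1 a (by simp))).add (ih fun y hy => h1 y (by simp [hy]))

theorem mul {R : Type*} [CommSemiring R] {S S' S'' : Set R} {x y : R} (hx : IsSumOf S r x)
    (hy : IsSumOf S' r' y) (h : ∀ a ∈ S, ∀ b ∈ S', a * b ∈ S'') :
    IsSumOf S'' (r * r') (x * y) := by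
  refine hx.map (AddMonoidHom.mulRight y) fun a ha => ?_
  have := hy.map (r' := 1) (AddMonoidHom.mulLeft a) fun b hb => of_mem (h a ha b hb)
  simpa using this

end IsSumOf

/-! ### Expansion of homogeneous formulas into products with many factors -/

section HeavyPath

section Size

variable {F : Type u} {σ : Type v}

theorem ArithFormula.one_le_size (Φ : ArithFormula F σ) : 1 ≤ Φ.size := by
  cases Φ <;> simp [ArithFormula.size]

theorem ArithFormula.size_le_sum {k : ℕ} (g : Fin k → ArithFormula F σ) (i : Fin k) :
    (g i).size ≤ ∑ i, (g i).size :=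
  Finset.single_le_sum (f := fun i => (g i).size) (fun _ _ => Nat.zero_le _) (Finset.mem_univ i)

end Size

variable {F : Type u} {σ : Type v} [Field F]

/-- Products of a constant with gate polynomials of positive degrees that add up to `d`, each
computed by a homogeneous formula of size at most `s`, where the number of factors satisfies `ok`. -/
def gateProducts (F : Type u) (σ : Type v) [Field F] (s d : ℕ) (ok : ℕ → Prop) :
    Set (MvPolynomial σ F) :=
  {p | ∃ (b : F) (L : Multiset (MvPolynomial σ F × ℕ)),
    (∀ x ∈ L, 0 < x.2 ∧ x.1.IsHomogeneous x.2 ∧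
      ∃ Ψ : ArithFormula F σ, Ψ.IsHomogeneous ∧ Ψ.size ≤ s ∧ Ψ.toPoly = x.1) ∧
    (L.map Prod.snd).sum = d ∧ ok (Multiset.card L) ∧
    p = MvPolynomial.C b * (L.map Prod.fst).prod}

theorem gateProducts_C_mul {s d : ℕ} {ok : ℕ → Prop} (a : F) {p : MvPolynomial σ F}
    (hp : p ∈ gateProducts F σ s d ok) : MvPolynomial.C a * p ∈ gateProducts F σ s d ok := by
  obtain ⟨b, L, h1, h2, h3, rfl⟩ := hp
  exact ⟨a * b, L, h1, h2, h3, by rw [map_mul, mul_assoc]⟩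

theorem ArithFormula.IsHomogeneous.exists_degree {Φ : ArithFormula F σ} (h : Φ.IsHomogeneous) :
    ∃ e, Φ.toPoly.IsHomogeneous e := by
  cases Φ with
  | var x => exact ⟨1, MvPolynomial.isHomogeneous_X _ _⟩
  | const a => exact ⟨0, MvPolynomial.isHomogeneous_C _ _⟩
  | sum k w g => exact h.1
  | prod k g => exact h.1

theorem MvPolynomial.IsHomogeneous.eq_C {p : MvPolynomial σ F} (h : p.IsHomogeneous 0) :
    p = MvPolynomial.C (p.coeff 0) :=
  MvPolynomial.totalDegree_eq_zero_iff_eq_C.1 (Nat.le_zero.1 h.totalDegree_le)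

/-- Expanding a homogeneous formula along the paths that descend, at every product gate, into a
child of largest degree. -/
theorem ArithFormula.isSumOf_gateProducts (s : ℕ) (Φ : ArithFormula F σ) :
    ∀ e : ℕ, 0 < e → Φ.IsHomogeneous → Φ.size ≤ s → Φ.toPoly.IsHomogeneous e →
      IsSumOf (gateProducts F σ s e fun m => 2 * e ≤ 2 ^ m) Φ.size Φ.toPoly := by
  classical
  induction Φ with
  | var x =>
    intro e he hΦ hs h
    have : e = 1 := h.inj_right (MvPolynomial.isHomogeneous_X F x) (MvPolynomial.X_ne_zero x)
    subst this
    -- Degree 1 with one factor is the equality case of `2 * e ≤ 2 ^ m`.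
    refine IsSumOf.of_mem ⟨1, {(MvPolynomial.X x, 1)}, ?_, by simp, by simp, by simp [toPoly]⟩
    intro y hy
    rw [Multiset.mem_singleton] at hy
    subst hy
    exact ⟨one_pos, MvPolynomial.isHomogeneous_X _ _, .var x, hΦ, hs, rfl⟩
  | const a =>
    intro e he hΦ hs h
    have h0 : (const a : ArithFormula F σ).toPoly = 0 := by
      by_contra hne
      exact he.ne' (h.inj_right (MvPolynomial.isHomogeneous_C σ a) hne)
    rw [h0]
    exact IsSumOf.zero
  | sum k w g ih =>
    intro e he hΦ hs h
    have hs' : ∀ i, (g i).size ≤ s := fun i => (size_le_sum g i).trans (by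
      simp only [size] at hs; omega)
    -- Children of degree other than `e` cancel in total, so projecting to degree `e` discards them.
    have key : (sum k w g).toPoly =
        ∑ i, MvPolynomial.C (w i) * MvPolynomial.homogeneousComponent e (g i).toPoly := by
      rw [← MvPolynomial.homogeneousComponent_of_mem h |>.trans (if_pos rfl)]
      simp [toPoly, map_sum, MvPolynomial.homogeneousComponent_C_mul]
    rw [key]
    refine (IsSumOf.sum (k := fun i => (g i).size) fun i _ => ?_).mono (by simp [size])
    obtain ⟨e', he'⟩ := (hΦ.2 i).exists_degree
    rw [MvPolynomial.homogeneousComponent_of_mem he']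
    split_ifs with hee
    · subst hee
      have := (ih i e he (hΦ.2 i) (hs' i) he').map (r' := 1)
        (AddMonoidHom.mulLeft (MvPolynomial.C (w i)))
        fun y hy => IsSumOf.of_mem (gateProducts_C_mul (w i) hy)
      simpa using this
    · rw [mul_zero]; exact IsSumOf.zero
  | prod k g ih =>
    intro e he hΦ hs h
    have hs' : ∀ i, (g i).size ≤ s := fun i => (size_le_sum g i).trans (by
      simp only [size] at hs; omega)
    -- Only a nonzero product forces the degrees of the children to add up to `e`.
    by_cases h0 : (prod k g).toPoly = 0
    · rw [h0]; exact IsSumOf.zero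
    choose δ hδ using fun i => (hΦ.2 i).exists_degree
    have hsum : ∑ i, δ i = e :=
      (MvPolynomial.IsHomogeneous.prod Finset.univ _ δ fun i _ => hδ i).inj_right h h0
    set P : Finset (Fin k) := Finset.univ.filter fun i => 0 < δ i with hP
    have hsumP : ∑ i ∈ P, δ i = e := by
      rw [← hsum]
      refine Finset.sum_subset (Finset.subset_univ _) fun i _ hi => ?_
      simpa [hP] using hi
    have hPne : P.Nonempty := by
      rw [Finset.nonempty_iff_ne_empty]
      rintro hemp
      rw [hemp] at hsumP
      simp at hsumP
      omega
    obtain ⟨i₀, hi₀, hmax⟩ := P.exists_max_image δ hPne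
    have hpos : 0 < δ i₀ := by simpa [hP] using hi₀
    -- Children of degree 0 are constants; they go into the scalar and do not count as factors.
    have hconst : ∏ i ∈ Finset.univ \ P, (g i).toPoly =
        MvPolynomial.C ((∏ i ∈ Finset.univ \ P, (g i).toPoly).coeff 0) := by
      refine MvPolynomial.IsHomogeneous.eq_C ?_
      have := MvPolynomial.IsHomogeneous.prod (Finset.univ \ P) (fun i => (g i).toPoly) δ
        fun i _ => hδ i
      rwa [Finset.sum_eq_zero fun i hi => by simpa [hP] using hi] at this
    set b := (∏ i ∈ Finset.univ \ P, (g i).toPoly).coeff 0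
    have hfact : (prod k g).toPoly =
        (MvPolynomial.C b * ∏ i ∈ P.erase i₀, (g i).toPoly) * (g i₀).toPoly := by
      rw [← hconst, mul_assoc, Finset.prod_erase_mul _ _ hi₀,
        Finset.prod_sdiff (Finset.subset_univ P)]
      rfl
    have hcard : (P.erase i₀).card + 1 = P.card := Finset.card_erase_add_one hi₀
    have hle : e ≤ P.card * δ i₀ := by
      rw [← hsumP, ← smul_eq_mul]
      exact Finset.sum_le_card_nsmul _ _ _ hmax
    rw [hfact]
    have := (ih i₀ (δ i₀) hpos (hΦ.2 i₀) (hs' i₀) (hδ i₀)).map (r' := 1)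
      (S' := gateProducts F σ s e fun m => 2 * e ≤ 2 ^ m)
      (AddMonoidHom.mulLeft (MvPolynomial.C b * ∏ i ∈ P.erase i₀, (g i).toPoly)) ?_
    · rw [mul_one] at this
      exact this.mono ((size_le_sum g i₀).trans (by simp [size]))
    rintro _ ⟨b', L, h1, h2, h3, rfl⟩
    refine IsSumOf.of_mem ⟨b * b', (P.erase i₀).val.map (fun i => ((g i).toPoly, δ i)) + L,
      ?_, ?_, ?_, ?_⟩
    · intro x hx
      rcases Multiset.mem_add.1 hx with hx | hx
      · obtain ⟨i, hi, rfl⟩ := Multiset.mem_map.1 hx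
        have hi' : i ∈ P := Finset.mem_of_mem_erase hi
        exact ⟨by simpa [hP] using hi', hδ i, g i, hΦ.2 i, hs' i, rfl⟩
      · exact h1 x hx
    · rw [Multiset.map_add, Multiset.sum_add, h2, Multiset.map_map, ← hsumP,
        ← Finset.sum_erase_add _ _ hi₀]
      rfl
    · change 2 * e ≤ _
      rw [Multiset.card_add, Multiset.card_map, Finset.card_val, pow_add]
      -- With p children of positive degree, the degree drops by a factor of at most p ≤ 2^(p-1),
      -- while p-1 factors are gained.
      have h4 : (P.erase i₀).card + 1 ≤ 2 ^ (P.erase i₀).card := Nat.lt_two_pow_self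
      calc 2 * e ≤ 2 * (P.card * δ i₀) := by omega
        _ = P.card * (2 * δ i₀) := by ring
        _ ≤ _ := Nat.mul_le_mul (hcard ▸ h4) h3
    · rw [Multiset.map_add, Multiset.prod_add, Multiset.map_map, MvPolynomial.C_mul]
      simp only [AddMonoidHom.coe_mulLeft, Finset.prod]
      simp only [Function.comp_def]
      ring

/-- Iterated expansion of factors of degree at least `2 ^ q`: as long as such a factor exists, a
single expansion produces at least `q` new factors. -/
theorem ArithFormula.isSumOf_gateProducts_pow {s d : ℕ} (q : ℕ) (hd : 0 < d)
    (Φ : ArithFormula F σ) (hΦ : Φ.IsHomogeneous) (hs : Φ.size ≤ s)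
    (h : Φ.toPoly.IsHomogeneous d) (k : ℕ) :
    IsSumOf (gateProducts F σ s d fun m => d ≤ m * 2 ^ q ∨ k * q ≤ m) (s ^ k) Φ.toPoly := by
  induction k with
  | zero =>
    refine IsSumOf.of_mem ⟨1, {(Φ.toPoly, d)}, ?_, by simp, by simp, by simp⟩
    intro y hy
    rw [Multiset.mem_singleton] at hy
    subst hy
    exact ⟨hd, h, Φ, hΦ, hs, rfl⟩
  | succ k ih =>
    rw [pow_succ]
    refine ih.map (AddMonoidHom.id _) ?_
    rintro _ ⟨b, L, h1, h2, h3, rfl⟩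
    by_cases hL : d ≤ Multiset.card L * 2 ^ q
    · refine IsSumOf.mono (IsSumOf.of_mem ?_) (Φ.one_le_size.trans hs)
      exact ⟨b, L, h1, h2, Or.inl hL, rfl⟩
    have h3' : k * q ≤ Multiset.card L := h3.resolve_left hL
    -- The degrees add up to `d`, so too few factors means that one of them is large.
    obtain ⟨x, hx, hxq⟩ : ∃ x ∈ L, 2 ^ q < x.2 := by
      by_contra! hcon
      apply hL
      rw [← h2, ← smul_eq_mul, ← Multiset.card_map Prod.snd L]
      refine Multiset.sum_le_card_nsmul _ _ fun y hy => ?_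
      obtain ⟨z, hz, rfl⟩ := Multiset.mem_map.1 hy
      exact hcon z hz
    obtain ⟨L', rfl⟩ := Multiset.exists_cons_of_mem hx
    obtain ⟨hx0, hxh, Ψ, hΨ, hΨs, hΨx⟩ := h1 x hx
    have hΨsum := Ψ.isSumOf_gateProducts s x.2 hx0 hΨ hΨs (hΨx ▸ hxh)
    have := hΨsum.map (r' := 1)
      (S' := gateProducts F σ s d fun m => d ≤ m * 2 ^ q ∨ (k + 1) * q ≤ m)
      (AddMonoidHom.mulLeft (MvPolynomial.C b * (L'.map Prod.fst).prod)) ?_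
    · rw [mul_one] at this
      rw [hΨx] at this
      refine IsSumOf.mono (?_ : IsSumOf _ Ψ.size _) hΨs
      convert this using 1
      simp only [AddMonoidHom.coe_mulLeft, AddMonoidHom.id_apply, Multiset.map_cons,
        Multiset.prod_cons]
      ring
    rintro _ ⟨b', L'', h1', h2', h3'', rfl⟩
    refine IsSumOf.of_mem ⟨b * b', L' + L'', ?_, ?_, Or.inr ?_, ?_⟩
    · intro y hy
      rcases Multiset.mem_add.1 hy with hy | hy
      · exact h1 y (Multiset.mem_cons_of_mem hy)
      · exact h1' y hy
    · rw [Multiset.map_cons, Multiset.sum_cons] at h2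
      rw [Multiset.map_add, Multiset.sum_add, h2', ← h2, add_comm]
    · have : 2 ^ (q + 1) < 2 ^ Multiset.card L'' := by
        rw [pow_succ]; omega
      have := (Nat.pow_lt_pow_iff_right (by norm_num)).1 this
      rw [Multiset.card_cons] at h3'
      rw [Multiset.card_add, add_mul]
      omega
    · rw [Multiset.map_add, Multiset.prod_add, MvPolynomial.C_mul]
      simp only [AddMonoidHom.coe_mulLeft]
      ring

theorem ArithFormula.card_vars_le_size [DecidableEq σ] (Φ : ArithFormula F σ) :
    Φ.toPoly.vars.card ≤ Φ.size := by
  induction Φ with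
  | var x => simp [toPoly, size]
  | const a => simp [toPoly, size]
  | sum k w g ih =>
    have hsub : (sum k w g).toPoly.vars ⊆ Finset.univ.biUnion fun i => (g i).toPoly.vars :=
      (MvPolynomial.vars_sum_subset _ _).trans
        (Finset.biUnion_mono fun i _ => (MvPolynomial.vars_mul _ _).trans (by simp))
    refine (Finset.card_le_card hsub).trans ?_
    refine Finset.card_biUnion_le.trans ((Finset.sum_le_sum fun i _ => ih i).trans ?_)
    simp [size]
  | prod k g ih =>
    refine (Finset.card_le_card (MvPolynomial.vars_prod _)).trans ?_
    refine Finset.card_biUnion_le.trans ((Finset.sum_le_sum fun i _ => ih i).trans ?_)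
    simp [size]

end HeavyPath

/-! ### Coefficient tensors and their rank -/

section Tensor

variable {F : Type u} [Field F] {d n : ℕ}

/-- Multiples of tensors of the form `κ ↦ ∏ j ∈ A, a j (κ j)`. -/
def rankOneOn (F : Type u) [Field F] (n : ℕ) (A : Finset (Fin d)) :
    Set ((Fin d → Fin n) → F) :=
  {T | ∃ (c : F) (a : Fin d → Fin n → F), ∀ κ, T κ = c * ∏ j ∈ A, a j (κ j)}

theorem mul_mem_rankOneOn {A B : Finset (Fin d)} (h : B ⊆ A) {T T' : (Fin d → Fin n) → F}
    (hT : T ∈ rankOneOn F n B) (hT' : T' ∈ rankOneOn F n (A \ B)) :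
    T * T' ∈ rankOneOn F n A := by
  obtain ⟨c, a, ha⟩ := hT
  obtain ⟨c', a', ha'⟩ := hT'
  refine ⟨c * c', fun j => if j ∈ B then a j else a' j, fun κ => ?_⟩
  have h1 : ∏ j ∈ B, (if j ∈ B then a j else a' j) (κ j) = ∏ j ∈ B, a j (κ j) :=
    Finset.prod_congr rfl fun j hj => by rw [if_pos hj]
  have h2 : ∏ j ∈ A \ B, (if j ∈ B then a j else a' j) (κ j) = ∏ j ∈ A \ B, a' j (κ j) :=
    Finset.prod_congr rfl fun j hj => by rw [if_neg (Finset.mem_sdiff.1 hj).2]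
  rw [← Finset.prod_sdiff h, h1, h2, Pi.mul_apply, ha, ha']
  ring

/-- Fix all coordinates in `A` but one: each of the resulting slices is a vector in the remaining
coordinate, hence of rank one. -/
theorem isSumOf_rankOneOn {A : Finset (Fin d)} (hA : A.Nonempty) (T : (Fin d → Fin n) → F)
    (hT : ∀ κ κ' : Fin d → Fin n, (∀ j ∈ A, κ j = κ' j) → T κ = T κ') :
    IsSumOf (rankOneOn F n A) (n ^ (A.card - 1)) T := by
  classical
  obtain ⟨j₀, hj₀⟩ := hA
  set B := A.erase j₀
  let ext (μ : B → Fin n) (k : Fin n) : Fin d → Fin n :=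
    fun j => if h : j ∈ B then μ ⟨j, h⟩ else k
  let a (μ : B → Fin n) (j : Fin d) (k : Fin n) : F :=
    if h : j ∈ B then (if k = μ ⟨j, h⟩ then 1 else 0) else T (ext μ k)
  have key : T = ∑ μ : B → Fin n, fun κ => 1 * ∏ j ∈ A, a μ j (κ j) := by
    funext κ
    rw [Finset.sum_apply, Finset.sum_eq_single fun j : B => κ j]
    · rw [one_mul, ← Finset.prod_erase_mul _ _ hj₀, Finset.prod_eq_one, one_mul]
      · have : j₀ ∉ B := Finset.notMem_erase _ _
        simp only [a, this, dite_false]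
        refine hT _ _ fun j hj => ?_
        by_cases h : j ∈ B
        · simp [ext, h]
        · have : j = j₀ := by
            by_contra hne
            exact h (Finset.mem_erase.2 ⟨hne, hj⟩)
          subst this
          simp [ext, h]
      · intro j hj
        have : j ∈ B := hj
        simp [a, this]
    · intro μ _ hμ
      obtain ⟨j, hj⟩ := Function.ne_iff.1 hμ
      rw [Finset.prod_eq_zero (Finset.mem_of_mem_erase j.2), mul_zero]
      simp only [a, j.2, dite_true]
      exact if_neg (Ne.symm hj)
    · simp
  rw [key]
  refine IsSumOf.mono (IsSumOf.sum (k := fun _ => 1) fun μ _ => IsSumOf.of_mem ?_) ?_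
  · exact ⟨1, a μ, fun κ => rfl⟩
  · rw [Finset.sum_const, Finset.card_univ, Fintype.card_fun, Fintype.card_coe, Fintype.card_fin,
      Finset.card_erase_of_mem hj₀, smul_eq_mul, mul_one]

/-- One elementary tensor per point of the box containing the support. -/
theorem isSumOf_rankOneOn_of_support (T : (Fin d → Fin n) → F) (V : Fin d → Finset (Fin n))
    (hT : ∀ κ, T κ ≠ 0 → ∀ j, κ j ∈ V j) :
    IsSumOf (rankOneOn F n Finset.univ) (∏ j, (V j).card) T := by
  classical
  have key : T = ∑ μ ∈ Fintype.piFinset V,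
      fun κ => T μ * ∏ j : Fin d, (if κ j = μ j then 1 else 0 : F) := by
    funext κ
    rw [Finset.sum_apply]
    by_cases h : T κ = 0
    · rw [h, Finset.sum_eq_zero]
      intro μ _
      by_cases hμ : μ = κ
      · rw [hμ, h, zero_mul]
      · obtain ⟨j, hj⟩ := Function.ne_iff.1 hμ
        rw [Finset.prod_eq_zero (Finset.mem_univ j) (if_neg (Ne.symm hj)), mul_zero]
    · rw [Finset.sum_eq_single κ]
      · simp
      · intro μ _ hμ
        obtain ⟨j, hj⟩ := Function.ne_iff.1 hμ
        rw [Finset.prod_eq_zero (Finset.mem_univ j) (if_neg (Ne.symm hj)), mul_zero]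
      · exact fun hκ => absurd (Fintype.mem_piFinset.2 (hT κ h)) hκ
  rw [key]
  refine IsSumOf.mono (IsSumOf.sum (k := fun _ => 1) fun μ _ => IsSumOf.of_mem ?_) ?_
  · exact ⟨T μ, fun j k => if k = μ j then 1 else 0, fun κ => rfl⟩
  · simp [Fintype.card_piFinset]

/-- The monomial `∏ j ∈ A, x_(j, κ j)`. -/
noncomputable def transversal (A : Finset (Fin d)) (κ : Fin d → Fin n) : Fin d × Fin n →₀ ℕ :=
  ∑ j ∈ A, Finsupp.single (j, κ j) 1

theorem transversal_apply (A : Finset (Fin d)) (κ : Fin d → Fin n) (j : Fin d) (k : Fin n) :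
    transversal A κ (j, k) = if j ∈ A ∧ κ j = k then 1 else 0 := by
  classical
  simp only [transversal, Finsupp.finsetSum_apply, Finsupp.single_apply, Prod.mk.injEq]
  by_cases h : j ∈ A
  · rw [Finset.sum_eq_single j]
    · simp [h]
    · intro b _ hb; simp [hb]
    · exact fun h' => absurd h h'
  · rw [if_neg (by tauto)]
    refine Finset.sum_eq_zero fun b hb => if_neg ?_
    rintro ⟨rfl, -⟩
    exact h hb

theorem transversal_congr {A : Finset (Fin d)} {κ κ' : Fin d → Fin n}
    (h : ∀ j ∈ A, κ j = κ' j) : transversal A κ = transversal A κ' :=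
  Finset.sum_congr rfl fun j hj => by rw [h j hj]

theorem degree_transversal (A : Finset (Fin d)) (κ : Fin d → Fin n) :
    (transversal A κ).degree = A.card := by
  simp [transversal, map_sum, Finsupp.degree_single]

/-- The tensor of coefficients of the monomials that contain exactly one variable from each part
in `A`, and no other variables. -/
noncomputable def coeffTensor (A : Finset (Fin d)) :
    MvPolynomial (Fin d × Fin n) F →+ ((Fin d → Fin n) → F) where
  toFun f κ := f.coeff (transversal A κ)
  map_zero' := by funext κ; simp
  map_add' f g := by funext κ; simp

theorem coeffTensor_apply (A : Finset (Fin d)) (f : MvPolynomial (Fin d × Fin n) F)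
    (κ : Fin d → Fin n) : coeffTensor A f κ = f.coeff (transversal A κ) := rfl

/-- A transversal monomial is squarefree, so its factorizations into two monomials correspond to the
subsets of `A`. -/
theorem coeffTensor_mul (A : Finset (Fin d)) (f g : MvPolynomial (Fin d × Fin n) F) :
    coeffTensor A (f * g) = ∑ B ∈ A.powerset, coeffTensor B f * coeffTensor (A \ B) g := by
  classical
  funext κ
  rw [coeffTensor_apply, MvPolynomial.coeff_mul, Finset.sum_apply]
  have hsplit : ∀ p ∈ Finset.HasAntidiagonal.antidiagonal (transversal A κ),
      p.1 = transversal (A.filter fun j => p.1 (j, κ j) = 1) κ ∧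
      p.2 = transversal (A \ A.filter fun j => p.1 (j, κ j) = 1) κ := by
    intro p hp
    rw [Finset.HasAntidiagonal.mem_antidiagonal] at hp
    have hjk : ∀ j k, p.1 (j, k) + p.2 (j, k) = if j ∈ A ∧ κ j = k then 1 else 0 := by
      intro j k
      rw [← transversal_apply, ← hp, Finsupp.add_apply]
    constructor <;>
    · ext ⟨j, k⟩
      have := hjk j k
      rw [transversal_apply]
      by_cases hj : j ∈ A <;> by_cases hk : κ j = k
      · subst hk
        simp only [hj, and_self, if_true] at this
        simp only [Finset.mem_sdiff, Finset.mem_filter, hj, true_and, and_true]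
        split_ifs <;> omega
      all_goals
        simp only [hj, hk, and_false, false_and, if_false] at this
        simp [hj, hk]
        omega
  have hmono : ∀ B ⊆ A, (A.filter fun j => transversal B κ (j, κ j) = 1) = B := by
    intro B hB
    ext j
    simp only [Finset.mem_filter, transversal_apply, and_true]
    by_cases hj : j ∈ B
    · simp [hj, hB hj]
    · simp [hj]
  refine Finset.sum_nbij' (fun p => A.filter fun j => p.1 (j, κ j) = 1)
    (fun B => (transversal B κ, transversal (A \ B) κ)) ?_ ?_ ?_ ?_ ?_
  · intro p _
    exact Finset.mem_powerset.2 (Finset.filter_subset _ _)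
  · intro B hB
    rw [Finset.HasAntidiagonal.mem_antidiagonal, add_comm]
    exact Finset.sum_sdiff (Finset.mem_powerset.1 hB)
  · intro p hp
    exact Prod.ext (hsplit p hp).1.symm (hsplit p hp).2.symm
  · intro B hB
    exact hmono B (Finset.mem_powerset.1 hB)
  · intro p hp
    rw [Pi.mul_apply, coeffTensor_apply, coeffTensor_apply, ← (hsplit p hp).1,
      ← (hsplit p hp).2]

theorem coeffTensor_eq_zero {A : Finset (Fin d)} {f : MvPolynomial (Fin d × Fin n) F} {e : ℕ}
    (hf : f.IsHomogeneous e) (h : A.card ≠ e) : coeffTensor A f = 0 := by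
  funext κ
  exact hf.coeff_eq_zero (by rwa [degree_transversal])

/-- The coefficient tensor of a product of homogeneous polynomials of degrees `e` is a sum of
at most `d ^ (∑ e)` products of coefficient tensors, each of which has rank at most
`n ^ (e - 1)`. -/
theorem isSumOf_coeffTensor_prod (L : Multiset (MvPolynomial (Fin d × Fin n) F × ℕ))
    (hL : ∀ x ∈ L, 0 < x.2 ∧ x.1.IsHomogeneous x.2) (A : Finset (Fin d)) :
    IsSumOf (rankOneOn F n A)
      (d ^ (L.map Prod.snd).sum * n ^ (L.map fun x => x.2 - 1).sum)
      (coeffTensor A (L.map Prod.fst).prod) := by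
  classical
  induction L using Multiset.induction_on generalizing A with
  | empty =>
    simp only [Multiset.map_zero, Multiset.prod_zero, Multiset.sum_zero, pow_zero, mul_one]
    by_cases hA : A = ∅
    · subst hA
      refine IsSumOf.of_mem ⟨1, fun _ _ => 1, fun κ => ?_⟩
      simp [coeffTensor_apply, transversal]
    · rw [coeffTensor_eq_zero (MvPolynomial.isHomogeneous_one _ _) (by simpa using hA)]
      exact IsSumOf.zero
  | cons x L ih =>
    obtain ⟨hx0, hxh⟩ := hL x (by simp)
    have ih' := ih fun y hy => hL y (by simp [hy])
    simp only [Multiset.map_cons, Multiset.prod_cons, Multiset.sum_cons]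
    -- By homogeneity only subsets whose size is the degree of the first factor contribute.
    have hsub : A.powersetCard x.2 ⊆ A.powerset := fun B hB =>
      Finset.mem_powerset.2 (Finset.mem_powersetCard.1 hB).1
    rw [coeffTensor_mul, ← Finset.sum_subset hsub]
    · refine (IsSumOf.sum (k := fun _ => n ^ (x.2 - 1) *
        (d ^ (L.map Prod.snd).sum * n ^ (L.map fun x => x.2 - 1).sum)) fun B hB => ?_).mono ?_
      · obtain ⟨hBA, hBc⟩ := Finset.mem_powersetCard.1 hB
        have hB0 : B.Nonempty := Finset.card_pos.1 (hBc ▸ hx0)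
        refine IsSumOf.mul ?_ (ih' (A \ B)) fun T hT T' hT' => mul_mem_rankOneOn hBA hT hT'
        rw [← hBc]
        refine isSumOf_rankOneOn hB0 _ fun κ κ' h => ?_
        rw [coeffTensor_apply, coeffTensor_apply, transversal_congr h]
      · rw [Finset.sum_const, Finset.card_powersetCard, smul_eq_mul]
        have hc : A.card.choose x.2 ≤ d ^ x.2 :=
          (Nat.choose_le_pow _ _).trans (Nat.pow_le_pow_left (by
            simpa using Finset.card_le_univ A) _)
        calc _ ≤ d ^ x.2 * (n ^ (x.2 - 1) *
              (d ^ (L.map Prod.snd).sum * n ^ (L.map fun x => x.2 - 1).sum)) :=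
              Nat.mul_le_mul_right _ hc
          _ = _ := by ring
    · intro B hB hB'
      rw [coeffTensor_eq_zero hxh, zero_mul]
      intro hc
      exact hB' (Finset.mem_powersetCard.2 ⟨Finset.mem_powerset.1 hB, hc⟩)

/-- The set-multilinear polynomial with a given coefficient tensor. -/
noncomputable def ofTensor : ((Fin d → Fin n) → F) →+ MvPolynomial (Fin d × Fin n) F where
  toFun T := ∑ κ, MvPolynomial.monomial (transversal Finset.univ κ) (T κ)
  map_zero' := by simp
  map_add' T T' := by simp [Finset.sum_add_distrib]

theorem transversal_univ_injective :
    Function.Injective (transversal (n := n) (Finset.univ : Finset (Fin d))) := by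
  intro κ κ' h
  funext j
  have := transversal_apply Finset.univ κ' j (κ j)
  rw [← h, transversal_apply] at this
  by_contra hne
  simp [Ne.symm hne] at this

theorem exists_transversal_eq (m : Fin d × Fin n →₀ ℕ)
    (hm : ∀ j : Fin d, ∑ k : Fin n, m (j, k) = 1) : ∃ κ, transversal Finset.univ κ = m := by
  classical
  have key : ∀ j : Fin d, ∃ k : Fin n, ∀ k', m (j, k') = if k = k' then 1 else 0 := by
    intro j
    obtain ⟨k, -, hk⟩ : ∃ k ∈ Finset.univ, m (j, k) ≠ 0 := by
      apply Finset.exists_ne_zero_of_sum_ne_zero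
      rw [hm j]; exact one_ne_zero
    refine ⟨k, fun k' => ?_⟩
    have h := hm j
    rw [← Finset.add_sum_erase _ _ (Finset.mem_univ k)] at h
    split_ifs with hkk
    · subst hkk; omega
    · exact Finset.sum_eq_zero_iff.1 (by omega : ∑ x ∈ Finset.univ.erase k, m (j, x) = 0) k'
        (by simp [Ne.symm hkk])
  choose κ hκ using key
  refine ⟨κ, ?_⟩
  ext ⟨j, k⟩
  rw [transversal_apply, hκ]
  simp

theorem ofTensor_coeffTensor {f : MvPolynomial (Fin d × Fin n) F} (hf : IsSetMultilinear f) :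
    ofTensor (coeffTensor Finset.univ f) = f := by
  classical
  ext m
  simp only [ofTensor, AddMonoidHom.coe_mk, ZeroHom.coe_mk, MvPolynomial.coeff_sum,
    MvPolynomial.coeff_monomial]
  by_cases h : ∃ κ, transversal Finset.univ κ = m
  · obtain ⟨κ, rfl⟩ := h
    simp [transversal_univ_injective.eq_iff, coeffTensor_apply]
  · push Not at h
    rw [Finset.sum_eq_zero fun κ _ => if_neg (h κ)]
    by_contra hne
    obtain ⟨κ, hκ⟩ := exists_transversal_eq m
      (hf m (MvPolynomial.mem_support_iff.2 (Ne.symm hne)))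
    exact h κ hκ

theorem IsSetMultilinear.isHomogeneous {f : MvPolynomial (Fin d × Fin n) F}
    (hf : IsSetMultilinear f) : f.IsHomogeneous d := by
  rw [← ofTensor_coeffTensor hf]
  refine MvPolynomial.IsHomogeneous.sum _ _ _ fun κ _ =>
    MvPolynomial.isHomogeneous_monomial _ ?_
  simp [degree_transversal]

theorem hasTensorDecomposition_ofTensor (hd : 1 ≤ d) {T : (Fin d → Fin n) → F}
    (hT : T ∈ rankOneOn F n Finset.univ) : HasTensorDecomposition (ofTensor T) 1 := by
  classical
  obtain ⟨c, a, ha⟩ := hT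
  -- The scalar is absorbed into the linear form of one part, which exists as `d ≥ 1`.
  let z : Fin d := ⟨0, hd⟩
  let a' : Fin d → Fin n → F := fun j k => (if j = z then c else 1) * a j k
  have ha' : ∀ κ, T κ = ∏ j, a' j (κ j) := by
    intro κ
    simp only [a']
    rw [ha, Finset.prod_mul_distrib, Finset.prod_ite_eq' Finset.univ z (fun _ => c)]
    simp
  refine ⟨fun _ => a', ?_⟩
  simp only [Finset.univ_unique, Finset.sum_singleton, ofTensor, AddMonoidHom.coe_mk,
    ZeroHom.coe_mk]
  rw [Finset.prod_univ_sum, Fintype.piFinset_univ]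
  refine Finset.sum_congr rfl fun κ _ => ?_
  rw [Finset.prod_mul_distrib, ← map_prod, ← ha', transversal, MvPolynomial.monomial_sum_index]
  rfl

theorem HasTensorDecomposition.add {f g : MvPolynomial (Fin d × Fin n) F} {r s : ℕ}
    (hf : HasTensorDecomposition f r) (hg : HasTensorDecomposition g s) :
    HasTensorDecomposition (f + g) (r + s) := by
  obtain ⟨a, rfl⟩ := hf
  obtain ⟨b, rfl⟩ := hg
  exact ⟨Fin.append a b, by simp [Fin.sum_univ_add]⟩

theorem tensorRank_le_of_isSumOf (hd : 1 ≤ d) {f : MvPolynomial (Fin d × Fin n) F}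
    (hf : IsSetMultilinear f) {r : ℕ}
    (h : IsSumOf (rankOneOn F n Finset.univ) r (coeffTensor Finset.univ f)) :
    tensorRank f ≤ r := by
  obtain ⟨l, h1, h2, h3⟩ := h
  suffices H : HasTensorDecomposition (ofTensor l.sum) (Multiset.card l) by
    rw [h2, ofTensor_coeffTensor hf] at H
    exact (Nat.sInf_le H).trans h3
  clear h2 h3
  induction l using Multiset.induction_on with
  | empty => exact ⟨Fin.elim0, by rw [Multiset.sum_zero, map_zero]; rfl⟩
  | cons T l ih =>
    rw [Multiset.sum_cons, map_add, Multiset.card_cons, add_comm (Multiset.card l)]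
    exact (hasTensorDecomposition_ofTensor hd (h1 T (by simp))).add
      (ih fun y hy => h1 y (by simp [hy]))

theorem tensorRank_le_pow_pred (hd : 1 ≤ d) {f : MvPolynomial (Fin d × Fin n) F}
    (hf : IsSetMultilinear f) : tensorRank f ≤ n ^ (d - 1) := by
  refine tensorRank_le_of_isSumOf hd hf ?_
  have hne : (Finset.univ : Finset (Fin d)).Nonempty := ⟨⟨0, hd⟩, Finset.mem_univ _⟩
  have := isSumOf_rankOneOn hne (coeffTensor Finset.univ f) fun κ κ' h => by
    rw [coeffTensor_apply, coeffTensor_apply, transversal_congr h]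
  simpa using this

theorem tensorRank_le_card_vars_pow (hd : 1 ≤ d) {f : MvPolynomial (Fin d × Fin n) F}
    (hf : IsSetMultilinear f) : tensorRank f ≤ f.vars.card ^ d := by
  classical
  refine tensorRank_le_of_isSumOf hd hf ?_
  let V : Fin d → Finset (Fin n) := fun j => Finset.univ.filter fun k => (j, k) ∈ f.vars
  refine (isSumOf_rankOneOn_of_support _ V fun κ hκ j => ?_).mono ?_
  · simp only [V, Finset.mem_filter, Finset.mem_univ, true_and, MvPolynomial.mem_vars_iff_mem_support]
    refine ⟨_, MvPolynomial.mem_support_iff.2 hκ, ?_⟩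
    rw [Finsupp.mem_support_iff, transversal_apply]
    simp
  · have hV : ∀ j, (V j).card ≤ f.vars.card := fun j =>
      Finset.card_le_card_of_injOn (fun k => (j, k)) (fun k hk => by simpa [V] using hk)
        fun k _ k' _ h => (Prod.mk.inj h).2
    refine (Finset.prod_le_prod' fun j _ => hV j).trans ?_
    simp

/-- The condition on `k` turns either alternative of the iterated expansion into `d ≤ l * 2 ^ q`, so
every product has at least `m` factors. -/
theorem tensorRank_le_of_homogeneous (hd : 1 ≤ d) (hn : 1 ≤ n)
    {f : MvPolynomial (Fin d × Fin n) F} (hf : IsSetMultilinear f)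
    {Φ : ArithFormula F (Fin d × Fin n)} (hΦ : Φ.IsHomogeneous) (hΦf : Φ.toPoly = f)
    {q k m : ℕ} (hk : d ≤ k * q * 2 ^ q) (hm : ∀ l : ℕ, d ≤ l * 2 ^ q → m ≤ l) :
    tensorRank f ≤ Φ.size ^ k * (d ^ d * n ^ (d - m)) := by
  refine tensorRank_le_of_isSumOf hd hf ?_
  have := Φ.isSumOf_gateProducts_pow q hd hΦ le_rfl (hΦf ▸ hf.isHomogeneous) k
  rw [hΦf] at this
  refine this.map (coeffTensor Finset.univ) ?_
  rintro _ ⟨b, L, h1, h2, h3, rfl⟩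
  have hlen : d ≤ Multiset.card L * 2 ^ q :=
    h3.elim id fun h => hk.trans (Nat.mul_le_mul_right _ h)
  have hdeg : (L.map fun x => x.2 - 1).sum + Multiset.card L = d := by
    refine Eq.trans ?_ h2
    clear h2 h3 hlen
    induction L using Multiset.induction_on with
    | empty => simp
    | cons x L ih =>
      have := ih fun y hy => h1 y (by simp [hy])
      have hx := (h1 x (by simp)).1
      simp only [Multiset.map_cons, Multiset.sum_cons, Multiset.card_cons]
      omega
  have hprod := isSumOf_coeffTensor_prod L (fun x hx => ⟨(h1 x hx).1, (h1 x hx).2.1⟩)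
    Finset.univ
  rw [h2] at hprod
  have hmul : coeffTensor Finset.univ (MvPolynomial.C b * (L.map Prod.fst).prod) =
      AddMonoidHom.mulLeft (fun _ => b) (coeffTensor Finset.univ (L.map Prod.fst).prod) := by
    funext κ
    simp [coeffTensor_apply]
  rw [hmul]
  refine (hprod.map (r' := 1) (AddMonoidHom.mulLeft fun _ => b) ?_).mono ?_
  · rintro T ⟨c, a, hT⟩
    exact IsSumOf.of_mem ⟨b * c, a, fun κ => by simp [hT, mul_assoc]⟩
  · rw [mul_one]
    have := hm _ hlen
    exact Nat.mul_le_mul_left _ (Nat.pow_le_pow_right hn (by omega))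

end Tensor

/-! ### Numerical estimates and choice of parameters -/

theorem exp_estimate {c : ℝ} (hc : 1 / 2 ≤ c) {q : ℕ} (hq : (q : ℝ) ≤ 8 * c + 1) :
    8 * c * 2 ^ q ≤ Real.exp (20 * c) := by
  have h2 : (2 : ℝ) ≤ Real.exp 1 := by linarith [Real.add_one_le_exp (1 : ℝ)]
  have h3 : (2 : ℝ) ^ q ≤ Real.exp (10 * c) :=
    calc (2 : ℝ) ^ q ≤ Real.exp 1 ^ q := by gcongr
      _ = Real.exp q := by rw [← Real.exp_nat_mul, mul_one]
      _ ≤ _ := Real.exp_le_exp.2 (by linarith)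
  have h4 : 8 * c ≤ Real.exp (10 * c) := by linarith [Real.add_one_le_exp (10 * c)]
  calc 8 * c * 2 ^ q ≤ Real.exp (10 * c) * Real.exp (10 * c) := by gcongr
    _ = Real.exp (20 * c) := by rw [← Real.exp_add]; ring_nf

/-- For small `c` the required saving is nearly all of `d`; the bound n^(cd) provides it. -/
theorem le_one_sub_inv_exp {c : ℝ} (hc : 0 < c) (hc' : c < 1 / 2) :
    c ≤ 1 - 1 / Real.exp (20 * c) := by
  have h : 1 / Real.exp (20 * c) ≤ 1 / (20 * c + 1) :=
    one_div_le_one_div_of_le (by linarith) (Real.add_one_le_exp _)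
  have h' : 1 / (20 * c + 1) ≤ 1 - c := by
    rw [div_le_iff₀ (by linarith)]
    nlinarith
  linarith

section Rank

variable {F : Type u} [Field F] {d n : ℕ} {f : MvPolynomial (Fin d × Fin n) F}
  {Φ : ArithFormula F (Fin d × Fin n)} {c : ℝ}

theorem tensorRank_le_rpow_of_size_le (hd : 1 ≤ d) (hf : IsSetMultilinear f)
    (hΦf : Φ.toPoly = f) (hs : (Φ.size : ℝ) ≤ (n : ℝ) ^ c) :
    (tensorRank f : ℝ) ≤ (n : ℝ) ^ (c * d) := by
  classical
  have h : tensorRank f ≤ Φ.size ^ d := (tensorRank_le_card_vars_pow hd hf).trans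
    (Nat.pow_le_pow_left (hΦf ▸ Φ.card_vars_le_size) _)
  calc (tensorRank f : ℝ) ≤ (Φ.size : ℝ) ^ d := by exact_mod_cast h
    _ ≤ ((n : ℝ) ^ c) ^ d := by gcongr
    _ = _ := by rw [Real.rpow_mul_natCast (Nat.cast_nonneg n)]

theorem tensorRank_le_rpow_of_homogeneous (hd : 1 ≤ d) (hn : 1 ≤ n) (hf : IsSetMultilinear f)
    (hΦ : Φ.IsHomogeneous) (hΦf : Φ.toPoly = f) (hs : (Φ.size : ℝ) ≤ (n : ℝ) ^ c) (hc : 0 < c)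
    {ε : ℝ} (hdn : (d : ℝ) ≤ (n : ℝ) ^ ε) {q : ℕ} (hq : 0 < q) :
    (tensorRank f : ℝ) ≤ (n : ℝ) ^ (c * (d / (q * 2 ^ q) + 1) + ε * d + (d - d / 2 ^ q)) := by
  have hn0 : (0 : ℝ) < n := by exact_mod_cast hn
  have hn1 : (1 : ℝ) ≤ n := by exact_mod_cast hn
  have hT : (0 : ℝ) < 2 ^ q := by positivity
  have hqT : (0 : ℝ) < q * 2 ^ q := by positivity
  obtain ⟨k, hk₁, hk'⟩ : ∃ k : ℕ, (d : ℝ) / (q * 2 ^ q) ≤ k ∧ (k : ℝ) ≤ d / (q * 2 ^ q) + 1 :=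
    ⟨_, Nat.le_ceil _, (Nat.ceil_lt_add_one (by positivity)).le⟩
  set m := ⌈(d : ℝ) / 2 ^ q⌉₊
  have hk : d ≤ k * q * 2 ^ q := by
    have := (div_le_iff₀ hqT).1 hk₁
    rw [← mul_assoc] at this
    exact_mod_cast this
  have hm : ∀ l : ℕ, d ≤ l * 2 ^ q → m ≤ l := fun l hl =>
    Nat.ceil_le.2 ((div_le_iff₀ hT).2 (by exact_mod_cast hl))
  have hmd : m ≤ d := hm d (Nat.le_mul_of_pos_right _ (by positivity))
  have hm' : (d : ℝ) / 2 ^ q ≤ m := Nat.le_ceil _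
  calc (tensorRank f : ℝ) ≤ (Φ.size : ℝ) ^ k * ((d : ℝ) ^ d * (n : ℝ) ^ (d - m)) := by
        exact_mod_cast tensorRank_le_of_homogeneous hd hn hf hΦ hΦf hk hm
    _ ≤ ((n : ℝ) ^ c) ^ k * (((n : ℝ) ^ ε) ^ d * (n : ℝ) ^ (d - m)) := by gcongr
    _ = (n : ℝ) ^ (c * k + ε * d + (d - m)) := by
        rw [← Real.rpow_mul_natCast hn0.le, ← Real.rpow_mul_natCast hn0.le,
          ← Real.rpow_natCast _ (d - m), ← Real.rpow_add hn0, ← Real.rpow_add hn0,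
          Nat.cast_sub hmd, add_assoc]
    _ ≤ _ := by
        refine Real.rpow_le_rpow_of_exponent_le hn1 ?_
        have := mul_le_mul_of_nonneg_left hk' hc.le
        linarith

end Rank
theorem mainTheorem5 :
    ∃ K : ℝ, 0 < K ∧
      ∀ c : ℝ, 0 < c →
      ∀ d : ℕ → ℕ, (∀ n, 1 ≤ d n) →
        (fun n : ℕ => Real.log (d n : ℝ)) =o[atTop] (fun n : ℕ => Real.log (n : ℝ)) →
      ∀ᶠ n : ℕ in atTop,
        ∀ (F : Type u) [Field F] (f : MvPolynomial (Fin (d n) × Fin n) F)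
          (Φ : ArithFormula F (Fin (d n) × Fin n)),
          IsSetMultilinear f →
          Φ.IsHomogeneous →
          Φ.toPoly = f →
          (Φ.size : ℝ) ≤ (n : ℝ) ^ c →
          (tensorRank f : ℝ) ≤ (n : ℝ) ^ (d n) / (n : ℝ) ^ ((d n : ℝ) / Real.exp (K * c)) := by
  refine ⟨20, by norm_num, fun c hc d hd hlog => ?_⟩
  set E := Real.exp (20 * c)
  have hE : 0 < E := Real.exp_pos _
  have hgoal : ∀ n : ℕ, 1 ≤ n → ∀ r y : ℝ, r ≤ (n : ℝ) ^ y → y ≤ d n - d n / E →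
      r ≤ (n : ℝ) ^ (d n) / (n : ℝ) ^ ((d n : ℝ) / E) := by
    intro n hn r y hr hy
    have hn0 : (0 : ℝ) < n := by exact_mod_cast hn
    rw [← Real.rpow_natCast, ← Real.rpow_sub hn0]
    exact hr.trans (Real.rpow_le_rpow_of_exponent_le (by exact_mod_cast hn) hy)
  rcases lt_or_ge c (1 / 2) with hc2 | hc2
  · filter_upwards [eventually_ge_atTop 1] with n hn F _ f Φ hf hΦ hΦf hs
    refine hgoal n hn _ _ (tensorRank_le_rpow_of_size_le (hd n) hf hΦf hs) ?_
    have := mul_le_mul_of_nonneg_right (le_one_sub_inv_exp hc hc2) (Nat.cast_nonneg (α := ℝ) (d n))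
    calc c * (d n : ℝ) ≤ (1 - 1 / E) * d n := this
      _ = _ := by ring
  · set q := ⌈8 * c⌉₊
    have hq : 8 * c ≤ q := Nat.le_ceil _
    have hq0 : 0 < q := Nat.ceil_pos.2 (by linarith)
    set T : ℝ := 2 ^ q
    have hT : 0 < T := by positivity
    have hET : 8 * c * T ≤ E := exp_estimate hc2 (Nat.ceil_lt_add_one (by linarith)).le
    filter_upwards [eventually_ge_atTop 1, hlog.def (show 0 < 1 / (4 * T) by positivity)]
      with n hn hlogn F _ f Φ hf hΦ hΦf hs
    have hn0 : (0 : ℝ) < n := by exact_mod_cast hn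
    have hd1 : (1 : ℝ) ≤ d n := by exact_mod_cast hd n
    -- For d ≤ E the required saving is at most one factor n. For d > E the additive `c` from
    -- rounding up `k` is negligible.
    rcases le_or_gt (d n : ℝ) E with hdE | hdE
    · refine hgoal n hn _ ((d n : ℝ) - 1) ?_ ?_
      · have : (tensorRank f : ℝ) ≤ (n : ℝ) ^ (d n - 1) := by
          exact_mod_cast tensorRank_le_pow_pred (hd n) hf
        rwa [← Real.rpow_natCast, Nat.cast_sub (hd n), Nat.cast_one] at this
      · linarith [(div_le_one hE).2 hdE]
    · have hdn : (d n : ℝ) ≤ (n : ℝ) ^ (1 / (4 * T)) := by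
        rw [Real.norm_of_nonneg (Real.log_nonneg hd1),
          Real.norm_of_nonneg (Real.log_nonneg (by exact_mod_cast hn))] at hlogn
        rw [Real.rpow_def_of_pos hn0, ← Real.log_le_iff_le_exp (by linarith), mul_comm]
        exact hlogn
      refine hgoal n hn _ _
        (tensorRank_le_rpow_of_homogeneous (hd n) hn hf hΦ hΦf hs hc hdn hq0) ?_
      -- Of the saving d/T, the expansion costs 1/8, rounding 1/8 and d^d 1/4; the remaining half is
      -- at least d/E.
      have hdT : 0 < (d n : ℝ) / T := by positivity
      have h1 : c * ((d n : ℝ) / (q * T)) ≤ d n / T / 8 := by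
        have hcq : c / q ≤ 1 / 8 := by
          rw [div_le_div_iff₀ (by exact_mod_cast hq0) (by norm_num)]
          linarith
        calc c * ((d n : ℝ) / (q * T)) = c / q * (d n / T) := by field_simp
          _ ≤ 1 / 8 * (d n / T) := by gcongr
          _ = _ := by ring
      have h2 : c ≤ d n / T / 8 := by
        rw [le_div_iff₀ (by norm_num), le_div_iff₀ hT]
        linarith
      have h3 : 1 / (4 * T) * d n = d n / T / 4 := by field_simp
      have h4 : (d n : ℝ) / E ≤ d n / T / 2 := by
        rw [div_div]
        refine div_le_div_of_nonneg_left (by linarith) (by positivity) ?_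
        nlinarith
      change c * ((d n : ℝ) / (q * T) + 1) + 1 / (4 * T) * d n + (d n - d n / T) ≤ d n - d n / E
      rw [h3]
      linarith
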